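/- Let $F$ be a perfect field with $\mathrm{char}(F)\ne 2,3$ and let $A$ be a unital (associative) finite-dimensional algebra over $F$. Write $[A,A]$ for the $F$-linear span of all commutators $xy-yx$, $x,y\in A$, and $\mathrm{rad}(A)$ for the radical of $A$, i.e. its unique maximal nilpotent ideal (equivalently, its Jacobson radical). If an $F$-linear map $T:A\to A$ satisfies $T(1)=1$ and $$T(x)^3-x^3\in[A,A]\quad\text{for all } x\in A,$$ then $T$ is the sum of a Jordan endomorphism of $A$ and an $F$-linear map from $A$ to $\mathrm{rad}(A)$; that is, there exist $F$-linear maps $J,R:A\to A$ with $T=J+R$, $J(xy+yx)=J(x)J(y)+J(y)J(x)$ for all $x,y\in A$, and $R(x)\in\mathrm{rad}(A)$ for all $x\in A$. -/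

import Mathlib

/-- The subspace `[A, A]`: the `F`-linear span of all commutators `x * y - y * x` in `A`. -/
def commutatorSpan (F A : Type*) [Field F] [Ring A] [Algebra F A] : Submodule F A :=
  Submodule.span F {c : A | ∃ x y : A, c = x * y - y * x}

/-- A linear map `J : A → A` is a Jordan endomorphism if it preserves the Jordan product
`x * y + y * x`. -/
def IsJordanEndomorphism {F A : Type*} [Field F] [Ring A] [Algebra F A] (J : A →ₗ[F] A) : Prop :=
  ∀ x y : A, J (x * y + y * x) = J x * J y + J y * J x

/-! Let `π : A → S` be the quotient by the radical and `G = π ∘ T`. Polarizing the cubic relation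
gives `T x * T y ≡ x * y` and `(T x * T y + T y * T x) * T z ≡ (x * y + y * x) * z` modulo `[A, A]`.
On the semisimple `S` the pairing `(a, b) ↦ a * b` modulo `[S, S]` is nondegenerate
(`IsSemisimpleRing.eq_zero_of_mul_mem_commutatorSpan`). The first relation thus forces `ker G ≤ ker
π`, so `G` is onto by dimension count; testing against `G z`, the two relations together make `G` a
Jordan homomorphism. Since `F` is perfect, `S` is separable and `π` has a multiplicative section `s`
(`exists_multiplicative_section`). Take `J = s ∘ G`; then `π` kills `T - J`. Separability elements
come from inverting `a ⊗ b ↦ (y ↦ a * y * b)` over the center of each simple factor; flipping such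
an element gives the nonzero trace behind nondegeneracy. -/

open scoped TensorProduct

/-! ### Central simple algebras are Azumaya -/

section Azumaya

variable (K B : Type*) [Field K] [Ring B] [Algebra K B]

attribute [local instance] TensorProduct.Algebra.module in
/-- A finite-dimensional central simple algebra is Azumaya. -/
theorem IsAzumaya.of_isCentral_of_isSimpleRing [Algebra.IsCentral K B] [IsSimpleRing B]
    [FiniteDimensional K B] : IsAzumaya K B where
  bij := by
    have smul_eq : ∀ (t : B ⊗[K] Bᵐᵒᵖ) (y : B), t • y = AlgHom.mulLeftRight K B t y :=
      fun _ _ ↦ rfl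
    have tmul_smul : ∀ a c y : B, (a ⊗ₜ[K] MulOpposite.op c) • y = a * y * c := by
      intro a c y
      rw [smul_eq, AlgHom.mulLeftRight_apply, MulOpposite.unop_op]
    have simple : IsSimpleModule (B ⊗[K] Bᵐᵒᵖ) B := by
      refine { exists_pair_ne := ⟨⊥, ⊤, bot_ne_top⟩, eq_bot_or_eq_top := fun p ↦ ?_ }
      let I : TwoSidedIdeal B := TwoSidedIdeal.mk' p p.zero_mem p.add_mem p.neg_mem
        (fun {x y} hy ↦ by
          have := p.smul_mem (x ⊗ₜ[K] MulOpposite.op 1) hy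
          rwa [tmul_smul, mul_one] at this)
        (fun {x y} hx ↦ by
          have := p.smul_mem (1 ⊗ₜ[K] MulOpposite.op y) hx
          rwa [tmul_smul, one_mul] at this)
      have hI : ∀ x, x ∈ I ↔ x ∈ p := fun x ↦ TwoSidedIdeal.mem_mk' ..
      refine or_iff_not_imp_left.2 fun hp ↦ ?_
      obtain ⟨x, hx, hx0⟩ := p.ne_bot_iff.1 hp
      have h1 := (hI 1).1 (IsSimpleRing.one_mem_of_ne_zero_mem I hx0 ((hI x).2 hx))
      refine (Submodule.eq_top_iff').2 fun y ↦ ?_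
      have := p.smul_mem (y ⊗ₜ[K] MulOpposite.op 1) h1
      rwa [tmul_smul, mul_one, mul_one] at this
    have surj : Function.Surjective (AlgHom.mulLeftRight K B) := by
      intro g
      -- Bimodule endomorphisms are scalars, so every `K`-linear `g` commutes with them; density on
      -- a basis then realizes `g` exactly.
      have central : ∀ φ : Module.End (B ⊗[K] Bᵐᵒᵖ) B, ∃ k : K, ∀ y, φ y = k • y := by
        intro φ
        have hl : ∀ y, φ y = y * φ 1 := fun y ↦ by
          have := φ.map_smul (y ⊗ₜ[K] MulOpposite.op 1) 1
          rwa [tmul_smul, tmul_smul, mul_one, mul_one, mul_one] at this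
        have hr : ∀ y, φ y = φ 1 * y := fun y ↦ by
          have := φ.map_smul (1 ⊗ₜ[K] MulOpposite.op y) 1
          rwa [tmul_smul, tmul_smul, one_mul, one_mul, one_mul] at this
        obtain ⟨k, hk⟩ := (Algebra.IsCentral.mem_center_iff K).1
          (Subalgebra.mem_center_iff.2 fun y ↦ (hl y).symm.trans (hr y) :
            φ 1 ∈ Subalgebra.center K B)
        exact ⟨k, fun y ↦ by rw [hr, hk, Algebra.smul_def]⟩
      let f : Module.End (Module.End (B ⊗[K] Bᵐᵒᵖ) B) B :=
        { toFun := g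
          map_add' := g.map_add
          map_smul' := fun φ y ↦ by
            obtain ⟨k, hk⟩ := central φ
            simp [Module.End.smul_def, hk] }
      let b := Module.finBasis K B
      classical
      obtain ⟨r, hr⟩ := jacobson_density (R := B ⊗[K] Bᵐᵒᵖ) f (Finset.univ.image b)
      refine ⟨r, b.ext fun i ↦ ?_⟩
      rw [← smul_eq, ← hr (b i) (Finset.mem_image_of_mem _ (Finset.mem_univ i))]
      rfl
    refine ⟨?_, surj⟩
    refine (LinearMap.injective_iff_surjective_of_finrank_eq_finrank
      (f := (AlgHom.mulLeftRight K B).toLinearMap) ?_).2 surj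
    rw [Module.finrank_tensorProduct, Module.finrank_linearMap,
      ← (MulOpposite.opLinearEquiv K (M := B)).finrank_eq]

end Azumaya

/-! ### Separability elements and traces -/

section Sandwich

variable (R A : Type*) [CommRing R] [Ring A] [Algebra R A]

/-- The linear map sending `a ⊗ b` to `y ↦ a * y * b`. -/
noncomputable def sandwich : A ⊗[R] A →ₗ[R] Module.End R A :=
  (AlgHom.mulLeftRight R A).toLinearMap ∘ₗ
    (MulOpposite.opLinearEquiv R (M := A)).toLinearMap.lTensor A

variable {R A}

@[simp]
theorem sandwich_tmul (a b y : A) : sandwich R A (a ⊗ₜ b) y = a * y * b := by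
  simp [sandwich]

theorem sandwich_bijective [IsAzumaya R A] : Function.Bijective (sandwich R A) :=
  IsAzumaya.bij.comp ((MulOpposite.opLinearEquiv R (M := A)).lTensor A).bijective

theorem sandwich_rTensor_mulLeft (x y : A) (t : A ⊗[R] A) :
    sandwich R A ((LinearMap.mulLeft R x).rTensor A t) y = x * sandwich R A t y := by
  induction t with
  | zero => simp
  | tmul a b => simp [mul_assoc]
  | add s t hs ht => simp [hs, ht, mul_add]

theorem sandwich_lTensor_mulRight (x y : A) (t : A ⊗[R] A) :
    sandwich R A ((LinearMap.mulRight R x).lTensor A t) y = sandwich R A t y * x := by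
  induction t with
  | zero => simp
  | tmul a b => simp [mul_assoc]
  | add s t hs ht => simp [hs, ht, add_mul]

theorem sandwich_comm_rTensor_mulLeft (x y : A) (t : A ⊗[R] A) :
    sandwich R A (TensorProduct.comm R A A ((LinearMap.mulLeft R x).rTensor A t)) y =
      sandwich R A (TensorProduct.comm R A A t) (y * x) := by
  induction t with
  | zero => simp
  | tmul a b => simp [mul_assoc]
  | add s t hs ht => simp [hs, ht]

theorem sandwich_comm_lTensor_mulRight (x y : A) (t : A ⊗[R] A) :
    sandwich R A (TensorProduct.comm R A A ((LinearMap.mulRight R x).lTensor A t)) y =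
      sandwich R A (TensorProduct.comm R A A t) (x * y) := by
  induction t with
  | zero => simp
  | tmul a b => simp [mul_assoc]
  | add s t hs ht => simp [hs, ht]

theorem sandwich_one (t : A ⊗[R] A) : sandwich R A t 1 = LinearMap.mul' R A t := by
  induction t with
  | zero => simp
  | tmul a b => simp
  | add s t hs ht => simp [hs, ht]

/-- A separability element of an algebra: an element `∑ uᵢ ⊗ vᵢ` with
`∑ x uᵢ ⊗ vᵢ = ∑ uᵢ ⊗ vᵢ x` for all `x`, and `∑ uᵢ vᵢ = 1`. -/
structure IsSeparabilityElement (t : A ⊗[R] A) : Prop where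
  rTensor_mulLeft : ∀ x : A,
    (LinearMap.mulLeft R x).rTensor A t = (LinearMap.mulRight R x).lTensor A t
  mul' : LinearMap.mul' R A t = 1

/-- For `t = ∑ uᵢ ⊗ vᵢ`, the flipped sandwich `y ↦ ∑ vᵢ y uᵢ` is a trace: moving `x` across `t`
turns `vᵢ y x uᵢ` into `vᵢ x y uᵢ`. -/
theorem IsSeparabilityElement.sandwich_comm_mul {t : A ⊗[R] A} (ht : IsSeparabilityElement t)
    (x y : A) : sandwich R A (TensorProduct.comm R A A t) (x * y) =
      sandwich R A (TensorProduct.comm R A A t) (y * x) := by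
  rw [← sandwich_comm_rTensor_mulLeft, ht.rTensor_mulLeft, sandwich_comm_lTensor_mulRight]

theorem IsSeparabilityElement.ne_zero [Nontrivial A] {t : A ⊗[R] A}
    (ht : IsSeparabilityElement t) : t ≠ 0 := by
  rintro rfl
  simpa using ht.mul'

/-- A projection onto the scalars has central values, so multiplying them by `x` on the left or on
the right agrees; injectivity of `sandwich` carries this back to its preimage. -/
theorem IsAzumaya.exists_isSeparabilityElement {K B : Type*} [Field K] [Ring B] [Nontrivial B]
    [Algebra K B] [IsAzumaya K B] : ∃ t : B ⊗[K] B, IsSeparabilityElement t := by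
  obtain ⟨l, hl⟩ := (LinearMap.toSpanSingleton K B 1).exists_leftInverse_of_injective
    (LinearMap.ker_toSpanSingleton K one_ne_zero)
  have hl1 : l 1 = 1 := by simpa using LinearMap.congr_fun hl 1
  obtain ⟨t, ht⟩ := sandwich_bijective.2 (Algebra.linearMap K B ∘ₗ l)
  refine ⟨t, fun x ↦ sandwich_bijective.1 (LinearMap.ext fun y ↦ ?_), ?_⟩
  · rw [sandwich_rTensor_mulLeft, sandwich_lTensor_mulRight, ht]
    exact (Algebra.commutes _ _).symm
  · rw [← sandwich_one, ht]
    simp [hl1]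

theorem IsAzumaya.exists_trace {K B : Type*} [Field K] [Ring B] [Nontrivial B]
    [Algebra K B] [IsAzumaya K B] : ∃ τ : B →ₗ[K] B, τ ≠ 0 ∧ ∀ x y, τ (x * y) = τ (y * x) := by
  obtain ⟨t, ht⟩ := IsAzumaya.exists_isSeparabilityElement (K := K) (B := B)
  refine ⟨sandwich K B (TensorProduct.comm K B B t), fun h ↦ ht.ne_zero ?_, ht.sandwich_comm_mul⟩
  exact (TensorProduct.comm K B B).injective
    (sandwich_bijective.1 (by rw [h, map_zero, map_zero]))

end Sandwich

/-! ### Separability in towers -/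

section Trans

variable {F K B : Type*} [CommRing F] [CommRing K] [Ring B] [Algebra F K] [Algebra K B]
  [Algebra F B] [IsScalarTower F K B]

/-- The bilinear map `(b, c) ↦ ∑ kᵢ b ⊗ lᵢ c` attached to `∑ kᵢ ⊗ lᵢ`. -/
noncomputable def twist (e : K ⊗[F] K) (b c : B) : B ⊗[F] B :=
  TensorProduct.map ((LinearMap.toSpanSingleton K B b).restrictScalars F)
    ((LinearMap.toSpanSingleton K B c).restrictScalars F) e

@[simp] theorem twist_zero (b c : B) : twist (0 : K ⊗[F] K) b c = 0 := by simp [twist]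

@[simp] theorem twist_tmul (b c : B) (k l : K) :
    twist (k ⊗ₜ[F] l) b c = (k • b) ⊗ₜ (l • c) := by simp [twist]

@[simp] theorem twist_add (b c : B) (e e' : K ⊗[F] K) :
    twist (e + e') b c = twist e b c + twist e' b c := by simp [twist]

theorem twist_add_left (e : K ⊗[F] K) (b b' c : B) :
    twist e (b + b') c = twist e b c + twist e b' c := by
  induction e with
  | zero => simp
  | tmul k l => simp [TensorProduct.add_tmul]
  | add s t hs ht => rw [twist_add, hs, ht, twist_add, twist_add]; abel

theorem twist_add_right (e : K ⊗[F] K) (b c c' : B) :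
    twist e b (c + c') = twist e b c + twist e b c' := by
  induction e with
  | zero => simp
  | tmul k l => simp [TensorProduct.tmul_add]
  | add s t hs ht => rw [twist_add, hs, ht, twist_add, twist_add]; abel

theorem twist_smul_left (e : K ⊗[F] K) (k : K) (b c : B) :
    twist e (k • b) c = twist ((LinearMap.mulLeft F k).rTensor K e) b c := by
  induction e with
  | zero => simp
  | tmul k l => simp [smul_smul, mul_comm]
  | add s t hs ht => simp [hs, ht]

theorem twist_smul_right (e : K ⊗[F] K) (k : K) (b c : B) :
    twist e b (k • c) = twist ((LinearMap.mulRight F k).lTensor K e) b c := by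
  induction e with
  | zero => simp
  | tmul k l => simp [smul_smul]
  | add s t hs ht => simp [hs, ht]

theorem mul'_twist (e : K ⊗[F] K) (b c : B) :
    LinearMap.mul' F B (twist e b c) = LinearMap.mul' F K e • (b * c) := by
  induction e with
  | zero => simp
  | tmul k l => simp [smul_smul, mul_comm]
  | add s t hs ht => simp [hs, ht, add_smul]

theorem rTensor_mulLeft_twist (e : K ⊗[F] K) (x b c : B) :
    (LinearMap.mulLeft F x).rTensor B (twist e b c) = twist e (x * b) c := by
  induction e with
  | zero => simp
  | tmul k l => simp
  | add s t hs ht => simp [hs, ht]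

theorem lTensor_mulRight_twist (e : K ⊗[F] K) (x b c : B) :
    (LinearMap.mulRight F x).lTensor B (twist e b c) = twist e b (c * x) := by
  induction e with
  | zero => simp
  | tmul k l => simp
  | add s t hs ht => simp [hs, ht]

/-- Separability is transitive in towers. -/
theorem exists_isSeparabilityElement_trans
    (h₁ : ∃ e : K ⊗[F] K, IsSeparabilityElement e) (h₂ : ∃ t : B ⊗[K] B, IsSeparabilityElement t) :
    ∃ t : B ⊗[F] B, IsSeparabilityElement t := by
  obtain ⟨e, he⟩ := h₁
  obtain ⟨t, ht⟩ := h₂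
  let Ψ : B ⊗[K] B →+ B ⊗[F] B := TensorProduct.liftAddHom
    (AddMonoidHom.mk' (fun b ↦ AddMonoidHom.mk' (twist e b) (twist_add_right e b))
      fun b b' ↦ AddMonoidHom.ext fun c ↦ twist_add_left e b b' c)
    -- Balancedness over `K` is exactly the commutation property of `e`.
    (fun k b c ↦ by
      change twist e (k • b) c = twist e b (k • c)
      rw [twist_smul_left, he.rTensor_mulLeft, twist_smul_right])
  have Ψ_tmul : ∀ b c, Ψ (b ⊗ₜ c) = twist e b c := fun b c ↦ rfl
  have hl : ∀ x s, (LinearMap.mulLeft F x).rTensor B (Ψ s) =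
      Ψ ((LinearMap.mulLeft K x).rTensor B s) := by
    intro x s
    induction s with
    | zero => simp
    | tmul b c => simp [Ψ_tmul, rTensor_mulLeft_twist]
    | add s t hs ht => simp [hs, ht]
  have hr : ∀ x s, (LinearMap.mulRight F x).lTensor B (Ψ s) =
      Ψ ((LinearMap.mulRight K x).lTensor B s) := by
    intro x s
    induction s with
    | zero => simp
    | tmul b c => simp [Ψ_tmul, lTensor_mulRight_twist]
    | add s t hs ht => simp [hs, ht]
  have hm : ∀ s, LinearMap.mul' F B (Ψ s) = LinearMap.mul' K B s := by
    intro s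
    induction s with
    | zero => simp
    | tmul b c => simp [Ψ_tmul, mul'_twist, he.mul']
    | add s t hs ht => simp [hs, ht]
  exact ⟨Ψ t, fun x ↦ by rw [hl, hr, ht.rTensor_mulLeft], by rw [hm, ht.mul']⟩

end Trans

/-! ### Separability of field extensions, isomorphic copies and products -/

section Constructions

theorem exists_isSeparabilityElement_of_isSeparable {F K : Type*} [Field F] [Field K] [Algebra F K]
    [Algebra.IsSeparable F K] [FiniteDimensional F K] :
    ∃ e : K ⊗[F] K, IsSeparabilityElement e := by
  have := Algebra.FormallyUnramified.of_isSeparable F K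
  refine ⟨Algebra.FormallyUnramified.elem F K, fun x ↦ ?_, ?_⟩
  · have h := Algebra.FormallyUnramified.one_tmul_mul_elem (R := F) x
    have hl : ∀ t : K ⊗[F] K, (LinearMap.mulLeft F x).rTensor K t = (x ⊗ₜ 1) * t := by
      intro t
      induction t with
      | zero => simp
      | tmul b c => simp
      | add s t hs ht => simp [hs, ht, mul_add]
    have hr : ∀ t : K ⊗[F] K, (LinearMap.mulRight F x).lTensor K t = (1 ⊗ₜ x) * t := by
      intro t
      induction t with
      | zero => simp
      | tmul b c => simp [mul_comm]
      | add s t hs ht => simp [hs, ht, mul_add]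
    rw [hl, hr, h]
  · exact Algebra.FormallyUnramified.lmul_elem

variable {R : Type*} [CommRing R]

theorem exists_isSeparabilityElement_congr {A B : Type*} [Ring A] [Ring B] [Algebra R A]
    [Algebra R B] (f : A ≃ₐ[R] B) (h : ∃ t : A ⊗[R] A, IsSeparabilityElement t) :
    ∃ t : B ⊗[R] B, IsSeparabilityElement t := by
  obtain ⟨t, ht⟩ := h
  refine ⟨TensorProduct.map f.toLinearMap f.toLinearMap t, fun y ↦ ?_, ?_⟩
  · obtain ⟨x, rfl⟩ := f.surjective y
    have hl : ∀ t, (LinearMap.mulLeft R (f x)).rTensor B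
        (TensorProduct.map f.toLinearMap f.toLinearMap t) =
        TensorProduct.map f.toLinearMap f.toLinearMap ((LinearMap.mulLeft R x).rTensor A t) := by
      intro t
      induction t with
      | zero => simp
      | tmul b c => simp
      | add s t hs ht => simp [hs, ht]
    have hr : ∀ t, (LinearMap.mulRight R (f x)).lTensor B
        (TensorProduct.map f.toLinearMap f.toLinearMap t) =
        TensorProduct.map f.toLinearMap f.toLinearMap ((LinearMap.mulRight R x).lTensor A t) := by
      intro t
      induction t with
      | zero => simp
      | tmul b c => simp
      | add s t hs ht => simp [hs, ht]
    rw [hl, hr, ht.rTensor_mulLeft]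
  · have hm : ∀ t, LinearMap.mul' R B (TensorProduct.map f.toLinearMap f.toLinearMap t) =
        f (LinearMap.mul' R A t) := by
      intro t
      induction t with
      | zero => simp
      | tmul b c => simp
      | add s t hs ht => simp [hs, ht]
    rw [hm, ht.mul', map_one]

theorem exists_isSeparabilityElement_pi {ι : Type*} [Finite ι] {A : ι → Type*}
    [∀ i, Ring (A i)] [∀ i, Algebra R (A i)]
    (h : ∀ i, ∃ t : A i ⊗[R] A i, IsSeparabilityElement t) :
    ∃ t : (∀ i, A i) ⊗[R] (∀ i, A i), IsSeparabilityElement t := by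
  classical
  have := Fintype.ofFinite ι
  choose t ht using h
  let s (i : ι) : A i →ₗ[R] ∀ i, A i := LinearMap.single R A i
  have hsl : ∀ i (x : ∀ i, A i) b, x * Pi.single i b = Pi.single i (x i * b) := by
    intro i x b
    ext j
    obtain rfl | hj := eq_or_ne j i <;> simp [*]
  have hsr : ∀ i (x : ∀ i, A i) b, Pi.single i b * x = Pi.single i (b * x i) := by
    intro i x b
    ext j
    obtain rfl | hj := eq_or_ne j i <;> simp [*]
  have hl : ∀ i (x : ∀ i, A i) t, (LinearMap.mulLeft R x).rTensor _ (TensorProduct.map (s i) (s i) t)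
      = TensorProduct.map (s i) (s i) ((LinearMap.mulLeft R (x i)).rTensor _ t) := by
    intro i x t
    induction t with
    | zero => simp
    | tmul b c => simp [s, hsl]
    | add s t hs ht => simp [hs, ht]
  have hr : ∀ i (x : ∀ i, A i) t, (LinearMap.mulRight R x).lTensor _ (TensorProduct.map (s i) (s i) t)
      = TensorProduct.map (s i) (s i) ((LinearMap.mulRight R (x i)).lTensor _ t) := by
    intro i x t
    induction t with
    | zero => simp
    | tmul b c => simp [s, hsr]
    | add s t hs ht => simp [hs, ht]
  have hm : ∀ i t, LinearMap.mul' R _ (TensorProduct.map (s i) (s i) t) =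
      s i (LinearMap.mul' R _ t) := by
    intro i t
    induction t with
    | zero => simp
    | tmul b c => simp [s, ← Pi.single_mul]
    | add s t hs ht => simp [hs, ht]
  refine ⟨∑ i, TensorProduct.map (s i) (s i) (t i), fun x ↦ ?_, ?_⟩
  · simp_rw [map_sum, hl, hr, (ht _).rTensor_mulLeft]
  · simp_rw [map_sum, hm, (ht _).mul']
    exact Finset.univ_sum_single 1

end Constructions

/-! ### Simple algebras, via their center -/

section Simple

universe u v

variable (F : Type u) (B : Type v) [Field F] [Ring B] [Algebra F B] [IsSimpleRing B]

/-- The center of a simple algebra is a field. -/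
noncomputable abbrev centerField : Field (Subalgebra.center F B) :=
  { (inferInstance : CommRing (Subalgebra.center F B)),
    (IsSimpleRing.isField_center B : IsField (Subalgebra.center F B)).toField with }

variable [FiniteDimensional F B]

theorem exists_field_isAzumaya : ∃ (K : Type v) (_ : Field K) (_ : Algebra F K) (_ : Algebra K B),
    IsScalarTower F K B ∧ FiniteDimensional F K ∧ IsAzumaya K B := by
  let fieldK : Field (Subalgebra.center F B) := centerField F B
  let algKB : Algebra (Subalgebra.center F B) B :=
    (Subalgebra.center F B).subtype.toAlgebra' fun c x ↦ (Subalgebra.mem_center_iff.1 c.2 x).symm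
  have tower : @IsScalarTower F (Subalgebra.center F B) B _ algKB.toSMul _ :=
    IsScalarTower.of_algebraMap_eq fun _ ↦ rfl
  have central : Algebra.IsCentral (Subalgebra.center F B) B :=
    ⟨fun x hx ↦ ⟨⟨x, Subalgebra.mem_center_iff.2 (Subalgebra.mem_center_iff.1 hx)⟩, rfl⟩⟩
  have finite : @Module.Finite (Subalgebra.center F B) B _ _ algKB.toModule :=
    Module.Finite.of_restrictScalars_finite F _ _
  exact ⟨Subalgebra.center F B, fieldK, inferInstance, algKB, tower, inferInstance,
    @IsAzumaya.of_isCentral_of_isSimpleRing _ _ fieldK _ algKB central _ finite⟩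

theorem IsSimpleRing.exists_isSeparabilityElement [PerfectField F] :
    ∃ t : B ⊗[F] B, IsSeparabilityElement t := by
  obtain ⟨K, _, _, _, _, _, _⟩ := exists_field_isAzumaya F B
  have : Algebra.IsSeparable F K := Algebra.IsAlgebraic.isSeparable_of_perfectField
  exact exists_isSeparabilityElement_trans (K := K) exists_isSeparabilityElement_of_isSeparable
    IsAzumaya.exists_isSeparabilityElement

theorem IsSimpleRing.exists_trace :
    ∃ τ : B →ₗ[F] B, τ ≠ 0 ∧ ∀ x y, τ (x * y) = τ (y * x) := by
  obtain ⟨K, _, _, _, _, _, _⟩ := exists_field_isAzumaya F B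
  obtain ⟨τ, h0, h⟩ := IsAzumaya.exists_trace (K := K) (B := B)
  exact ⟨τ.restrictScalars F,
    fun h' ↦ h0 (LinearMap.restrictScalars_injective F h'), h⟩

end Simple

/-! ### Nondegeneracy modulo commutators -/

section Semisimple

variable {F S : Type*} [Field F] [Ring S] [Algebra F S] [IsSemisimpleRing S]
  [FiniteDimensional F S]

theorem IsSemisimpleRing.exists_isSeparabilityElement [PerfectField F] :
    ∃ t : S ⊗[F] S, IsSeparabilityElement t := by
  obtain ⟨n, D, d, _, _, _, _, ⟨e⟩⟩ :=
    IsSemisimpleRing.exists_algEquiv_pi_matrix_divisionRing_finite F S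
  exact exists_isSeparabilityElement_congr e.symm (exists_isSeparabilityElement_pi fun i ↦
    IsSimpleRing.exists_isSeparabilityElement F _)

theorem map_mem_commutatorSpan {A B : Type*} [Ring A] [Algebra F A] [Ring B] [Algebra F B]
    (f : A →ₐ[F] B) {a : A} (ha : a ∈ commutatorSpan F A) : f a ∈ commutatorSpan F B := by
  have : commutatorSpan F A ≤ (commutatorSpan F B).comap f.toLinearMap := by
    refine Submodule.span_le.2 ?_
    rintro _ ⟨x, y, rfl⟩
    exact Submodule.subset_span ⟨f x, f y, by simp⟩
  exact this ha

theorem sub_mem_commutatorSpan {A : Type*} [Ring A] [Algebra F A] (x y : A) :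
    x * y - y * x ∈ commutatorSpan F A := Submodule.subset_span ⟨x, y, rfl⟩

theorem IsSimpleRing.commutatorSpan_ne_top (B : Type*) [Ring B] [Algebra F B] [IsSimpleRing B]
    [FiniteDimensional F B] : commutatorSpan F B ≠ ⊤ := by
  intro h
  obtain ⟨τ, h0, hτ⟩ := IsSimpleRing.exists_trace F B
  have hle : commutatorSpan F B ≤ LinearMap.ker τ := by
    refine Submodule.span_le.2 ?_
    rintro _ ⟨x, y, rfl⟩
    simp [hτ x y]
  rw [h] at hle
  exact h0 (LinearMap.ker_eq_top.1 (top_le_iff.1 hle))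

/-- Such `a` form a two-sided ideal, because `b * a * x ≡ a * x * b` modulo commutators. It omits
`1`, since a nonzero trace keeps `[B, B]` proper. -/
theorem IsSimpleRing.eq_zero_of_mul_mem_commutatorSpan {B : Type*} [Ring B] [Algebra F B]
    [IsSimpleRing B] [FiniteDimensional F B] {a : B} (ha : ∀ x, a * x ∈ commutatorSpan F B) :
    a = 0 := by
  by_contra h0
  let I : TwoSidedIdeal B := TwoSidedIdeal.mk' {a | ∀ x, a * x ∈ commutatorSpan F B}
    (fun x ↦ by simp)
    (fun {a b} ha hb x ↦ by rw [add_mul]; exact add_mem (ha x) (hb x))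
    (fun {a} ha x ↦ by rw [neg_mul]; exact neg_mem (ha x))
    (fun {b a} ha x ↦ by
      have := add_mem (sub_mem_commutatorSpan (F := F) b (a * x)) (ha (x * b))
      rwa [mul_assoc a x b, ← mul_assoc a x b, sub_add_cancel, ← mul_assoc] at this)
    (fun {a b} ha x ↦ by rw [mul_assoc]; exact ha _)
  have h1 : (1 : B) ∈ I := IsSimpleRing.one_mem_of_ne_zero_mem I h0
    ((TwoSidedIdeal.mem_mk' ..).2 ha)
  have h1' : ∀ x, 1 * x ∈ commutatorSpan F B := (TwoSidedIdeal.mem_mk' ..).1 h1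
  exact IsSimpleRing.commutatorSpan_ne_top (F := F) B
    (Submodule.eq_top_iff'.2 fun x ↦ by simpa using h1' x)

theorem IsSemisimpleRing.eq_zero_of_mul_mem_commutatorSpan {a : S}
    (ha : ∀ x, a * x ∈ commutatorSpan F S) : a = 0 := by
  obtain ⟨n, D, d, _, _, _, _, ⟨e⟩⟩ :=
    IsSemisimpleRing.exists_algEquiv_pi_matrix_divisionRing_finite F S
  refine e.injective ((funext fun i ↦ ?_ : e a = 0).trans (map_zero e).symm)
  refine IsSimpleRing.eq_zero_of_mul_mem_commutatorSpan (F := F) fun x ↦ ?_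
  have := map_mem_commutatorSpan ((Pi.evalAlgHom F _ i).comp e.toAlgHom)
    (ha (e.symm (Pi.single i x)))
  simpa using this

end Semisimple

/-! ### Wedderburn principal theorem -/

section Splitting

variable {F A S : Type*} [Field F] [Ring A] [Algebra F A] [Ring S] [Algebra F S]

/-- The failure of a linear map to be multiplicative. -/
noncomputable def mulDefect (s : S →ₗ[F] A) : S →ₗ[F] S →ₗ[F] A :=
  (LinearMap.mul F A).compl₁₂ s s - (LinearMap.mul F S).compr₂ s

@[simp]
theorem mulDefect_apply (s : S →ₗ[F] A) (x y : S) :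
    mulDefect s x y = s x * s y - s (x * y) := by
  simp [mulDefect]

theorem IsSeparabilityElement.exists_sum {t : S ⊗[F] S} (ht : IsSeparabilityElement t) :
    ∃ (n : ℕ) (u v : Fin n → S), ∑ i, u i * v i = 1 ∧
      ∀ (β : S →ₗ[F] S →ₗ[F] A) (x : S), ∑ i, β (x * u i) (v i) = ∑ i, β (u i) (v i * x) := by
  obtain ⟨n, u, v, rfl⟩ : ∃ (n : ℕ) (u v : Fin n → S), t = ∑ i, u i ⊗ₜ[F] v i := by
    obtain ⟨p, hp⟩ := TensorProduct.exists_finset t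
    refine ⟨p.card, fun i ↦ (p.equivFin.symm i).1.1, fun i ↦ (p.equivFin.symm i).1.2, ?_⟩
    rw [hp, ← Finset.sum_coe_sort, ← p.equivFin.symm.sum_comp]
  refine ⟨n, u, v, by simpa using ht.mul', fun β x ↦ ?_⟩
  simpa using congrArg (TensorProduct.lift β) (ht.rTensor_mulLeft x)

/-- The defect `f` of a linear section is a Hochschild 2-cocycle up to higher order. Separability
provides the contracting homotopy `h x = ∑ s uᵢ * f vᵢ x`, and replacing `s` by `s - h` gains one
power of `N`. -/
theorem exists_linear_section_mulDefect_mem_pow (π : A →ₐ[F] S) (hπ : Function.Surjective π)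
    {N : Ideal A} [N.IsTwoSided] (hN : ∀ a, a ∈ N ↔ π a = 0)
    (hS : ∃ t : S ⊗[F] S, IsSeparabilityElement t) (k : ℕ) :
    ∃ s : S →ₗ[F] A, (∀ x, π (s x) = x) ∧ ∀ x y, mulDefect s x y ∈ N ^ (k + 1) := by
  induction k with
  | zero =>
    obtain ⟨s, hs⟩ := π.toLinearMap.exists_rightInverse_of_surjective
      (LinearMap.range_eq_top.2 hπ)
    have hs' : ∀ x, π (s x) = x := LinearMap.congr_fun hs
    exact ⟨s, hs', fun x y ↦ by
      rw [zero_add, Submodule.pow_one, hN]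
      simp [hs']⟩
  | succ k ih =>
    obtain ⟨s, hs, hf⟩ := ih
    obtain ⟨t, ht⟩ := hS
    obtain ⟨n, u, v, h1, hβ⟩ := ht.exists_sum (A := A)
    let f := mulDefect s
    let h : S →ₗ[F] A := ∑ i, LinearMap.mulLeft F (s (u i)) ∘ₗ f (v i)
    have h_apply : ∀ x, h x = ∑ i, s (u i) * f (v i) x := fun x ↦ by simp [h]
    have h_mem : ∀ x, h x ∈ N ^ (k + 1) := fun x ↦ by
      rw [h_apply]
      exact sum_mem fun i _ ↦ Ideal.mul_mem_left _ _ (hf _ _)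
    have pow_le : N ^ (k + 1) ≤ N := Ideal.pow_le_self k.succ_ne_zero
    have mul_mem : ∀ {a b}, a ∈ N → b ∈ N ^ (k + 1) → a * b ∈ N ^ (k + 1 + 1) := by
      intro a b ha hb
      rw [Submodule.pow_succ' N k.succ_ne_zero]
      exact Ideal.mul_mem_mul ha hb
    have hshift : ∀ x y, ∑ i, s (u i) * f (v i * x) y = ∑ i, s (x * u i) * f (v i) y := by
      intro x y
      simpa using (hβ ((LinearMap.mul F A).compl₁₂ s (f.flip y)) x).symm
    refine ⟨s - h, fun x ↦ ?_, fun x y ↦ ?_⟩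
    · have := (hN _).1 (pow_le (h_mem x))
      simp [hs, this]
    -- An exact identity in which each term is a product of an element of `N` and one of `N ^ (k +
    -- 1)`; the first factor lies in `N` because `∑ uᵢ vᵢ = 1`.
    · have key : mulDefect (s - h) x y = (1 - ∑ i, s (u i) * s (v i)) * f x y +
          -∑ i, f x (u i) * f (v i) y + h x * h y := by
        -- The cocycle identity for `f` at `(vᵢ, x, y)`, multiplied by `s uᵢ` and summed.
        have e1 : (∑ i, s (u i) * s (v i)) * f x y - ∑ i, s (u i) * f (v i * x) y +
            h (x * y) - h x * s y = 0 := by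
          rw [h_apply, h_apply, Finset.sum_mul, Finset.sum_mul, ← Finset.sum_sub_distrib,
            ← Finset.sum_add_distrib, ← Finset.sum_sub_distrib]
          refine Finset.sum_eq_zero fun i _ ↦ ?_
          simp only [f, mulDefect_apply, mul_assoc]
          noncomm_ring
        have e2 : ∑ i, f x (u i) * f (v i) y = s x * h y - ∑ i, s (x * u i) * f (v i) y := by
          rw [h_apply, Finset.mul_sum, ← Finset.sum_sub_distrib]
          refine Finset.sum_congr rfl fun i _ ↦ ?_
          simp only [f, mulDefect_apply]
          noncomm_ring
        have e3 : mulDefect (s - h) x y = f x y - s x * h y - h x * s y + h (x * y) +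
            h x * h y := by
          simp only [f, mulDefect_apply, LinearMap.sub_apply]
          noncomm_ring
        rw [e2, ← hshift, e3, sub_mul, one_mul]
        rw [← sub_eq_zero, ← e1]
        abel
      rw [key]
      refine add_mem (add_mem (mul_mem ?_ (hf x y)) (neg_mem (sum_mem fun i _ ↦ ?_))) ?_
      · rw [hN]
        simp [hs, h1]
      · exact mul_mem (pow_le (hf _ _)) (hf _ _)
      · exact mul_mem (pow_le (h_mem x)) (h_mem y)

/-- The existence part of the **Wedderburn principal theorem**: a surjection onto a separable
algebra with nilpotent kernel has a multiplicative linear section. -/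
theorem exists_multiplicative_section (π : A →ₐ[F] S) (hπ : Function.Surjective π)
    {N : Ideal A} [N.IsTwoSided] (hN : ∀ a, a ∈ N ↔ π a = 0) (hnil : IsNilpotent N)
    (hS : ∃ t : S ⊗[F] S, IsSeparabilityElement t) :
    ∃ s : S →ₗ[F] A, (∀ x, π (s x) = x) ∧ ∀ x y, s (x * y) = s x * s y := by
  obtain ⟨n, hn⟩ := hnil
  obtain ⟨s, hs, hf⟩ := exists_linear_section_mulDefect_mem_pow π hπ hN hS n
  refine ⟨s, hs, fun x y ↦ ?_⟩
  have := Ideal.pow_le_pow_right n.le_succ (hf x y)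
  rw [hn, Ideal.zero_eq_bot, Ideal.mem_bot, mulDefect_apply] at this
  exact (sub_eq_zero.1 this).symm

end Splitting

/-! ### Polarizing the cubic relation -/

section Polarization

variable {F A : Type*} [Field F] [Ring A] [Algebra F A]

theorem mem_of_nat_smul_mem {p : Submodule F A} {n : ℕ} (hn : (n : F) ≠ 0) {a : A}
    (ha : n • a ∈ p) : a ∈ p := by
  rw [← Nat.cast_smul_eq_nsmul F] at ha
  exact (p.smul_mem_iff hn).1 ha

theorem mul_sub_mul_mem_commutatorSpan (h2 : (2 : F) ≠ 0) (h3 : (3 : F) ≠ 0) {T : A →ₗ[F] A}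
    (hT1 : T 1 = 1) (hT : ∀ x : A, T x ^ 3 - x ^ 3 ∈ commutatorSpan F A) (x y : A) :
    T x * T y - x * y ∈ commutatorSpan F A := by
  have hsq : ∀ x, T x ^ 2 - x ^ 2 ∈ commutatorSpan F A := by
    intro x
    refine mem_of_nat_smul_mem (F := F) (n := 3) (by exact_mod_cast h3)
      (mem_of_nat_smul_mem (F := F) (n := 2) (by exact_mod_cast h2) ?_)
    -- `(a + 1) ^ 3 - (a - 1) ^ 3 = 6 a ^ 2 + 2`, used for `a = T x` and `a = x`.
    have := sub_mem (hT (x + 1)) (add_mem (hT (x - 1)) (add_mem (hT 1) (hT 1)))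
    convert! this using 1
    simp only [map_add, map_sub, hT1]
    noncomm_ring
  refine mem_of_nat_smul_mem (F := F) (n := 2) (by exact_mod_cast h2) ?_
  have := add_mem (sub_mem (sub_mem (hsq (x + y)) (hsq x)) (hsq y))
    (sub_mem (sub_mem_commutatorSpan (F := F) (T x) (T y)) (sub_mem_commutatorSpan x y))
  convert! this using 1
  simp only [map_add]
  noncomm_ring

theorem jordan_mul_sub_mem_commutatorSpan (h3 : (3 : F) ≠ 0) {T : A →ₗ[F] A}
    (hT : ∀ x : A, T x ^ 3 - x ^ 3 ∈ commutatorSpan F A) (x y z : A) :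
    (T x * T y + T y * T x) * T z - (x * y + y * x) * z ∈ commutatorSpan F A := by
  -- The alternating sum is the sum of `abc` over all six orderings; cyclic invariance modulo
  -- commutators groups them into three copies of `abc + bac`.
  have polar : ∀ a b c : A, 3 • ((a * b + b * a) * c) - ((a + b + c) ^ 3 - (a + b) ^ 3 -
      (a + c) ^ 3 - (b + c) ^ 3 + a ^ 3 + b ^ 3 + c ^ 3) ∈ commutatorSpan F A := by
    intro a b c
    have := add_mem (add_mem (sub_mem_commutatorSpan (F := F) (a * b) c)
      (sub_mem_commutatorSpan a (b * c))) (add_mem (sub_mem_commutatorSpan b (a * c))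
      (sub_mem_commutatorSpan (b * a) c))
    convert! this using 1
    noncomm_ring
  refine mem_of_nat_smul_mem (F := F) (n := 3) (by exact_mod_cast h3) ?_
  have h7 := add_mem (add_mem (add_mem (sub_mem (sub_mem (sub_mem (hT (x + y + z)) (hT (x + y)))
    (hT (x + z))) (hT (y + z))) (hT x)) (hT y)) (hT z)
  have := add_mem (sub_mem (polar (T x) (T y) (T z)) (polar x y z)) h7
  convert! this using 1
  simp only [map_add, smul_sub]
  abel

end Polarization

/-! ### The Jordan homomorphism modulo the radical -/

theorem corollary3p8 {F A : Type*} [Field F] [PerfectField F] [Ring A] [Algebra F A]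
    [FiniteDimensional F A] (hF2 : ringChar F ≠ 2) (hF3 : ringChar F ≠ 3)
    (T : A →ₗ[F] A) (hT1 : T 1 = 1)
    (hT : ∀ x : A, T x ^ 3 - x ^ 3 ∈ commutatorSpan F A) :
    ∃ J R : A →ₗ[F] A, IsJordanEndomorphism J ∧ (∀ x : A, R x ∈ Ring.jacobson A) ∧
      T = J + R := by
  have h2 : (2 : F) ≠ 0 := Ring.two_ne_zero hF2
  have h3 : (3 : F) ≠ 0 := fun h ↦ by
    have hdvd : ringChar F ∣ 3 := ringChar.dvd (by exact_mod_cast h)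
    exact ((Nat.dvd_prime Nat.prime_three).1 hdvd).elim CharP.ringChar_ne_one hF3
  have : IsArtinianRing A := isArtinian_of_tower F inferInstance
  let π : A →ₐ[F] A ⧸ Ring.jacobson A := Ideal.Quotient.mkₐ F (Ring.jacobson A)
  have hπ : Function.Surjective π := Ideal.Quotient.mkₐ_surjective F _
  have hker : ∀ a, a ∈ Ring.jacobson A ↔ π a = 0 := fun a ↦ Ideal.Quotient.eq_zero_iff_mem.symm
  have : FiniteDimensional F (A ⧸ Ring.jacobson A) :=
    Module.Finite.of_surjective π.toLinearMap hπ
  obtain ⟨s, hs, hmul⟩ := exists_multiplicative_section π hπ hker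
    IsSemiprimaryRing.isNilpotent IsSemisimpleRing.exists_isSeparabilityElement
  let G : A →ₗ[F] A ⧸ Ring.jacobson A := π.toLinearMap ∘ₗ T
  have G_apply : ∀ x, G x = π (T x) := fun x ↦ rfl
  have G_ker : LinearMap.ker G ≤ LinearMap.ker π.toLinearMap := by
    intro x hx
    rw [LinearMap.mem_ker, G_apply] at hx
    refine IsSemisimpleRing.eq_zero_of_mul_mem_commutatorSpan (F := F) fun z ↦ ?_
    obtain ⟨y, rfl⟩ := hπ z
    have := map_mem_commutatorSpan π (mul_sub_mul_mem_commutatorSpan h2 h3 hT1 hT x y)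
    rw [map_sub, map_mul, map_mul, hx, zero_mul, zero_sub] at this
    exact neg_mem_iff.1 this
  have G_surj : Function.Surjective G := by
    have e1 := G.finrank_range_add_finrank_ker
    have e2 := π.toLinearMap.finrank_range_add_finrank_ker
    have e3 := Submodule.finrank_mono G_ker
    rw [LinearMap.range_eq_top.2 hπ, finrank_top] at e2
    exact LinearMap.range_eq_top.1 (Submodule.eq_top_of_finrank_eq
      (le_antisymm (Submodule.finrank_le _) (by omega)))
  have G_jordan : ∀ x y, G (x * y + y * x) = G x * G y + G y * G x := by
    intro x y
    rw [eq_comm, ← sub_eq_zero]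
    refine IsSemisimpleRing.eq_zero_of_mul_mem_commutatorSpan (F := F) fun z ↦ ?_
    obtain ⟨z, rfl⟩ := G_surj z
    -- Both relations share the term `(x * y + y * x) * z`, which cancels and leaves the Jordan
    -- defect of `G` times `G z`.
    have := map_mem_commutatorSpan π (sub_mem (jordan_mul_sub_mem_commutatorSpan h3 hT x y z)
      (mul_sub_mul_mem_commutatorSpan h2 h3 hT1 hT (x * y + y * x) z))
    rw [sub_sub_sub_cancel_right, ← sub_mul] at this
    simpa only [map_sub, map_mul, map_add, G_apply] using this
  refine ⟨s ∘ₗ G, T - s ∘ₗ G, fun x y ↦ ?_, fun x ↦ ?_, (add_sub_cancel _ _).symm⟩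
  · rw [LinearMap.comp_apply, G_jordan, map_add, hmul, hmul]
    rfl
  · rw [hker]
    simp [hs, G_apply]
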